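/- Let $k$ be a commutative unital ring; all algebras are associative $k$-algebras, not necessarily unital, and all bimodules over them are $k$-modules with $k$-bilinear actions (the case $k=\mathbb Z$ is that of rings and their bimodules). A set of orthogonal local units of an algebra $\mathcal R$ is a set $E\subseteq\mathcal R$ of pairwise orthogonal idempotents such that $\mathcal R=\bigoplus_{e\in E}\mathcal R e=\bigoplus_{e\in E}e\mathcal R$. A Morita context $(\mathcal R,\mathcal R',M,M',\tau,\tau')$ consists of an $\mathcal R$-$\mathcal R'$-bimodule $M$, an $\mathcal R'$-$\mathcal R$-bimodule $M'$, an $\mathcal R$-bimodule map $\tau:M\otimes_{\mathcal R'}M'\to\mathcal R$ and an $\mathcal R'$-bimodule map $\tau':M'\otimes_{\mathcal R}M\to\mathcal R'$ such that $\tau(m_1\otimes m')\,m_2=m_1\,\tau'(m'\otimes m_2)$ and $\tau'(m_1'\otimes m)\,m_2'=m_1'\,\tau(m\otimes m_2')$ for all $m,m_1,m_2\in M$ and $m',m_1',m_2'\in M'$. For a set $X$ and a $k$-module $N$, let $\mathrm{FMat}_X(N)$ be the $k$-module of all $X\times X$-matrices over $N$ with only finitely many nonzero entries. With matrix multiplication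 $\mathrm{FMat}_X(\mathcal R)$ and $\mathrm{FMat}_X(\mathcal R')$ are algebras, and $\mathrm{FMat}_X(M)$ is an $\mathrm{FMat}_X(\mathcal R)$-$\mathrm{FMat}_X(\mathcal R')$-bimodule. **Theorem.** Let $\mathcal R$ and $\mathcal R'$ be algebras with sets of orthogonal local units $E$ and $F$ respectively, and let $X$ be an infinite set with $|X|\ge|E|$ and $|X|\ge|F|$. Let $(\mathcal R,\mathcal R',M,M',\tau,\tau')$ be a Morita context in which $M$ and $M'$ are unital on both sides, that is, $\mathcal R M=M=M\mathcal R'$ and $\mathcal R'M'=M'=M'\mathcal R$, and in which $\tau$ and $\tau'$ are surjective. Then there exist $k$-linear bijections $$\Psi:\mathrm{FMat}_X(\mathcal R)\to\mathrm{FMat}_X(M),\qquad \Psi':\mathrm{FMat}_X(\mathcal R')\to\mathrm{FMat}_X(M)$$ such that $\Psi$ (written on the right of its argument) is an isomorphism of left $\mathrm{FMat}_X(\mathcal R)$-modules, $\Psi'$ is an isomorphism of right $\mathrm{FMat}_X(\mathcal R')$-modules, and $$(A\Psi)A'=A(\Psi'A')\qquad\text{for all }A\in\mathrm{FMat}_X(\mathcal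 R),\ A'\in\mathrm{FMat}_X(\mathcal R').$$ -/

import Mathlib

open scoped TensorProduct

noncomputable section

namespace StableMorita

/-- A set `E` of pairwise orthogonal idempotents of the (not necessarily unital) algebra `R`
is a set of orthogonal local units if `R = ⨁ R e = ⨁ e R`, where `e` runs over `E`. -/
structure IsOrthogonalLocalUnits (k : Type*) {R : Type*} [CommRing k] [NonUnitalRing R]
    [Module k R] [IsScalarTower k R R] [SMulCommClass k R R] (E : Set R) : Prop where
  idempotent : ∀ e ∈ E, e * e = e
  orthogonal : ∀ e ∈ E, ∀ f ∈ E, e ≠ f → e * f = 0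
  left_sum : letI := Classical.decEq E
    DirectSum.IsInternal (fun e : E => LinearMap.range (LinearMap.mulRight k (e : R)))
  right_sum : letI := Classical.decEq E
    DirectSum.IsInternal (fun e : E => LinearMap.range (LinearMap.mulLeft k (e : R)))

/-- An `R`-`S`-bimodule structure on the `k`-module `M`, where `R` and `S` are (not necessarily
unital) `k`-algebras: `k`-bilinear associative actions of `R` on the left and of `S` on the right
which commute. -/
structure Bimodule (k R S M : Type*) [CommRing k] [NonUnitalRing R] [Module k R]
    [NonUnitalRing S] [Module k S] [AddCommGroup M] [Module k M] where
  /-- the left action `(r, m) ↦ r m` -/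
  left : R →ₗ[k] M →ₗ[k] M
  /-- the right action `(m, s) ↦ m s` -/
  right : M →ₗ[k] S →ₗ[k] M
  mul_left : ∀ (r₁ r₂ : R) (m : M), left (r₁ * r₂) m = left r₁ (left r₂ m)
  right_mul : ∀ (m : M) (s₁ s₂ : S), right m (s₁ * s₂) = right (right m s₁) s₂
  left_right : ∀ (r : R) (m : M) (s : S), right (left r m) s = left r (right m s)

/-- The bimodule `M` is unital on both sides: `R M = M` and `M S = M`. -/
structure Bimodule.IsUnital {k R S M : Type*} [CommRing k] [NonUnitalRing R] [Module k R]
    [NonUnitalRing S] [Module k S] [AddCommGroup M] [Module k M]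
    (B : Bimodule k R S M) : Prop where
  left_unital : Submodule.span k {x : M | ∃ (r : R) (m : M), x = B.left r m} = ⊤
  right_unital : Submodule.span k {x : M | ∃ (m : M) (s : S), x = B.right m s} = ⊤

/-- The relations `m s ⊗ n = m ⊗ s n` in `M ⊗[k] N`. -/
def balancedRelations {k R S T M N : Type*} [CommRing k] [NonUnitalRing R] [Module k R]
    [NonUnitalRing S] [Module k S] [NonUnitalRing T] [Module k T]
    [AddCommGroup M] [Module k M] [AddCommGroup N] [Module k N]
    (B : Bimodule k R S M) (B' : Bimodule k S T N) : Submodule k (M ⊗[k] N) :=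
  Submodule.span k
    {x | ∃ (m : M) (s : S) (n : N), x = (B.right m s) ⊗ₜ[k] n - m ⊗ₜ[k] (B'.left s n)}

/-- The tensor product `M ⊗_S N` of an `R`-`S`-bimodule and an `S`-`T`-bimodule over the
(not necessarily unital) algebra `S`. -/
abbrev BalancedTensor {k R S T M N : Type*} [CommRing k] [NonUnitalRing R] [Module k R]
    [NonUnitalRing S] [Module k S] [NonUnitalRing T] [Module k T]
    [AddCommGroup M] [Module k M] [AddCommGroup N] [Module k N]
    (B : Bimodule k R S M) (B' : Bimodule k S T N) : Type _ :=
  (M ⊗[k] N) ⧸ balancedRelations B B'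

/-- The class of `m ⊗ n` in `M ⊗_S N`. -/
def btmul {k R S T M N : Type*} [CommRing k] [NonUnitalRing R] [Module k R]
    [NonUnitalRing S] [Module k S] [NonUnitalRing T] [Module k T]
    [AddCommGroup M] [Module k M] [AddCommGroup N] [Module k N]
    (B : Bimodule k R S M) (B' : Bimodule k S T N) (m : M) (n : N) : BalancedTensor B B' :=
  (balancedRelations B B').mkQ (m ⊗ₜ[k] n)

/-- A Morita context `(R, R', M, M', τ, τ')` of (not necessarily unital) `k`-algebras.
That `τ` and `τ'` are bimodule maps is expressed on the elementary tensors, which span. -/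
structure MoritaContext (k R R' M M' : Type*) [CommRing k]
    [NonUnitalRing R] [Module k R] [NonUnitalRing R'] [Module k R']
    [AddCommGroup M] [Module k M] [AddCommGroup M'] [Module k M'] where
  /-- `M` is an `R`-`R'`-bimodule -/
  bimod : Bimodule k R R' M
  /-- `M'` is an `R'`-`R`-bimodule -/
  bimod' : Bimodule k R' R M'
  /-- `τ : M ⊗_{R'} M' → R` -/
  τ : BalancedTensor bimod bimod' →ₗ[k] R
  /-- `τ' : M' ⊗_R M → R'` -/
  τ' : BalancedTensor bimod' bimod →ₗ[k] R'
  τ_left : ∀ (r : R) (m : M) (m' : M'),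
    τ (btmul bimod bimod' (bimod.left r m) m') = r * τ (btmul bimod bimod' m m')
  τ_right : ∀ (m : M) (m' : M') (r : R),
    τ (btmul bimod bimod' m (bimod'.right m' r)) = τ (btmul bimod bimod' m m') * r
  τ'_left : ∀ (r' : R') (m' : M') (m : M),
    τ' (btmul bimod' bimod (bimod'.left r' m') m) = r' * τ' (btmul bimod' bimod m' m)
  τ'_right : ∀ (m' : M') (m : M) (r' : R'),
    τ' (btmul bimod' bimod m' (bimod.right m r')) = τ' (btmul bimod' bimod m' m) * r'
  /-- `τ(m₁ ⊗ m') m₂ = m₁ τ'(m' ⊗ m₂)` -/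
  assoc : ∀ (m₁ : M) (m' : M') (m₂ : M),
    bimod.left (τ (btmul bimod bimod' m₁ m')) m₂ = bimod.right m₁ (τ' (btmul bimod' bimod m' m₂))
  /-- `τ'(m₁' ⊗ m) m₂' = m₁' τ(m ⊗ m₂')` -/
  assoc' : ∀ (m₁' : M') (m : M) (m₂' : M'),
    bimod'.left (τ' (btmul bimod' bimod m₁' m)) m₂' =
      bimod'.right m₁' (τ (btmul bimod bimod' m m₂'))

/-- `FMat X M`: the `X × X`-matrices over `M` with only finitely many nonzero entries; the
`(i, j)` entry of `A` is `A (i, j)`. -/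
abbrev FMat (X M : Type*) [Zero M] : Type _ := X × X →₀ M

/-- In a product of two matrices with finitely many nonzero entries only finitely many entries
are nonzero. -/
theorem FMat.mul_support_finite {k X M N P : Type*} [CommRing k]
    [AddCommGroup M] [Module k M] [AddCommGroup N] [Module k N] [AddCommGroup P] [Module k P]
    (β : M →ₗ[k] N →ₗ[k] P) (A : FMat X M) (B : FMat X N) :
    (Function.support
      (fun p : X × X => ∑ᶠ l : X, β (A (p.1, l)) (B (l, p.2)))).Finite := by
  classical
  refine (((A.support.image Prod.fst) ×ˢ (B.support.image Prod.snd)).finite_toSet).subset ?_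
  rintro ⟨i, j⟩ h
  obtain ⟨l, hl⟩ : ∃ l : X, β (A (i, l)) (B (l, j)) ≠ 0 := by
    by_contra hcon
    push Not at hcon
    exact h (by simp [hcon])
  simp only [Finset.coe_product, Finset.coe_image, Set.mem_prod, Set.mem_image, Finset.mem_coe,
    Finsupp.mem_support_iff]
  refine ⟨⟨(i, l), fun h0 => hl ?_, rfl⟩, ⟨(l, j), fun h0 => hl ?_, rfl⟩⟩
  · simp [h0]
  · simp [h0]

/-- The matrix product `(A B)(i, j) = ∑ l, A(i, l) B(l, j)`, where the entries are multiplied by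
means of the bilinear map `β`.  The sum has only finitely many nonzero terms. -/
def FMat.mul {k X M N P : Type*} [CommRing k]
    [AddCommGroup M] [Module k M] [AddCommGroup N] [Module k N] [AddCommGroup P] [Module k P]
    (β : M →ₗ[k] N →ₗ[k] P) (A : FMat X M) (B : FMat X N) : FMat X P :=
  Finsupp.ofSupportFinite (fun p : X × X => ∑ᶠ l : X, β (A (p.1, l)) (B (l, p.2)))
    (FMat.mul_support_finite β A B)

theorem FMat.mul_apply {k X M N P : Type*} [CommRing k]
    [AddCommGroup M] [Module k M] [AddCommGroup N] [Module k N] [AddCommGroup P] [Module k P]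
    (β : M →ₗ[k] N →ₗ[k] P) (A : FMat X M) (B : FMat X N) (i j : X) :
    FMat.mul β A B (i, j) = ∑ᶠ l : X, β (A (i, l)) (B (l, j)) := rfl

end StableMorita

end


/-!
A bilinear map `V × W → N` is treated as an object whose morphisms are pairs of linear maps, one on
`V` and one in the opposite direction on `W`, adjoint to each other. An element `m` of `M` is then
a morphism `r ↦ r m`, `s ↦ m s` from the action pairing `R × M → M` to `M × R' → M`, and an element
of `M'` is one in the opposite direction by means of `τ` and `τ'`. Since `τ` and `τ'` are onto,
every local unit acts as a finite sum of composites of two such morphisms, so each of the two action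
pairings is a retract of a direct sum of copies of the other. As `X` is infinite, the `X`-fold sums
of the two pairings are retracts of each other and absorb countably many copies of themselves, and
the Eilenberg swindle makes them isomorphic. Applying the two halves of the isomorphism to the rows
of `A` and to the columns of `A'` gives `Ψ` and `Ψ'` with `(A Ψ) A' = A (Ψ' A')`; since matrices
over `M` are detected by their products with matrices over `R` and over `R'`, this identity forces
`Ψ` and `Ψ'` to be linear over the matrix algebras.
-/

noncomputable section

namespace StableMorita

section AdjointPairs

variable {k N V W V' W' V'' W'' : Type*} [CommRing k] [AddCommGroup N] [Module k N]
  [AddCommGroup V] [Module k V] [AddCommGroup W] [Module k W]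
  [AddCommGroup V'] [Module k V'] [AddCommGroup W'] [Module k W']
  [AddCommGroup V''] [Module k V''] [AddCommGroup W''] [Module k W'']

/-- A morphism from the pairing `β` to the pairing `β'`, both with values in `N`: a pair of linear
maps in opposite directions which are adjoint to each other (a morphism of Chu spaces). -/
structure AdjointPair (β : V →ₗ[k] W →ₗ[k] N) (β' : V' →ₗ[k] W' →ₗ[k] N) where
  fwd : V →ₗ[k] V'
  bwd : W' →ₗ[k] W
  adj : ∀ v w, β' (fwd v) w = β v (bwd w)

/-- An isomorphism of pairings: an adjoint pair of linear equivalences. -/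
structure AdjointEquiv (β : V →ₗ[k] W →ₗ[k] N) (β' : V' →ₗ[k] W' →ₗ[k] N) where
  fwd : V ≃ₗ[k] V'
  bwd : W' ≃ₗ[k] W
  adj : ∀ v w, β' (fwd v) w = β v (bwd w)

/-- Data exhibiting the pairing `β` as a retract of the pairing `β'`. -/
structure PairingRetract (β : V →ₗ[k] W →ₗ[k] N) (β' : V' →ₗ[k] W' →ₗ[k] N) where
  i : AdjointPair β β'
  r : AdjointPair β' β
  fwd_fwd : ∀ v, r.fwd (i.fwd v) = v
  bwd_bwd : ∀ w, i.bwd (r.bwd w) = w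

variable {β : V →ₗ[k] W →ₗ[k] N} {β' : V' →ₗ[k] W' →ₗ[k] N} {β'' : V'' →ₗ[k] W'' →ₗ[k] N}

/-- Composition of morphisms of pairings. -/
@[simps]
def AdjointPair.comp (g : AdjointPair β' β'') (f : AdjointPair β β') : AdjointPair β β'' where
  fwd := g.fwd ∘ₗ f.fwd
  bwd := f.bwd ∘ₗ g.bwd
  adj v w := by simp [f.adj, g.adj]

namespace AdjointEquiv

/-- The inverse of an isomorphism of pairings. -/
def symm (f : AdjointEquiv β β') : AdjointEquiv β' β where
  fwd := f.fwd.symm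
  bwd := f.bwd.symm
  adj v w := by simpa using (f.adj (f.fwd.symm v) (f.bwd.symm w)).symm

/-- Composition of isomorphisms of pairings, in diagrammatic order. -/
def trans (f : AdjointEquiv β β') (g : AdjointEquiv β' β'') : AdjointEquiv β β'' where
  fwd := f.fwd.trans g.fwd
  bwd := g.bwd.trans f.bwd
  adj v w := by simp [f.adj, g.adj]

/-- The morphism underlying an isomorphism of pairings. -/
def toAdjointPair (f : AdjointEquiv β β') : AdjointPair β β' where
  fwd := f.fwd
  bwd := f.bwd
  adj := f.adj

/-- Isomorphic pairings are retracts of each other. -/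
def toPairingRetract (f : AdjointEquiv β β') : PairingRetract β β' where
  i := f.toAdjointPair
  r := f.symm.toAdjointPair
  fwd_fwd := f.fwd.symm_apply_apply
  bwd_bwd := f.bwd.apply_symm_apply

end AdjointEquiv

/-- A retract of a retract is a retract. -/
def PairingRetract.trans (f : PairingRetract β β') (g : PairingRetract β' β'') :
    PairingRetract β β'' where
  i := g.i.comp f.i
  r := f.r.comp g.r
  fwd_fwd v := by simp [g.fwd_fwd, f.fwd_fwd]
  bwd_bwd w := by simp [g.bwd_bwd, f.bwd_bwd]

section Sum

variable {ι κ : Type*}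

/-- The orthogonal direct sum of copies of the pairing `β` indexed by `ι`. -/
def sumPairing (ι : Type*) (β : V →ₗ[k] W →ₗ[k] N) : (ι →₀ V) →ₗ[k] (ι →₀ W) →ₗ[k] N :=
  Finsupp.lsum k fun i => LinearMap.lcomp k N (Finsupp.lapply i) ∘ₗ β

theorem sumPairing_apply (v : ι →₀ V) (w : ι →₀ W) :
    sumPairing ι β v w = v.sum fun i x => β x (w i) := by
  simp [sumPairing, Finsupp.sum]

@[simp]
theorem sumPairing_single_left (i : ι) (x : V) (w : ι →₀ W) :
    sumPairing ι β (Finsupp.single i x) w = β x (w i) := by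
  simp [sumPairing]

@[simp]
theorem sumPairing_single_right (i : ι) (v : ι →₀ V) (y : W) :
    sumPairing ι β v (Finsupp.single i y) = β (v i) y := by
  classical
  rw [sumPairing_apply, Finsupp.sum_eq_single i] <;> simp +contextual

theorem sumPairing_adj_of_single_left {f : (ι →₀ V) →ₗ[k] V'} {g : W' →ₗ[k] (ι →₀ W)}
    (h : ∀ i x w, β' (f (Finsupp.single i x)) w = β x (g w i)) (v : ι →₀ V) (w : W') :
    β' (f v) w = sumPairing ι β v (g w) := by
  induction v using Finsupp.induction_linear with
  | zero => simp
  | add v₁ v₂ h₁ h₂ => simp [h₁, h₂]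
  | single i x => simp [h]

theorem sumPairing_adj_of_single_right {f : V' →ₗ[k] (ι →₀ V)} {g : (ι →₀ W) →ₗ[k] W'}
    (h : ∀ i v y, β (f v i) y = β' v (g (Finsupp.single i y))) (v : V') (w : ι →₀ W) :
    sumPairing ι β (f v) w = β' v (g w) := by
  induction w using Finsupp.induction_linear with
  | zero => simp
  | add w₁ w₂ h₁ h₂ => simp [h₁, h₂]
  | single i y => simp [h]

variable (ι) in
/-- The direct sum of copies of a morphism of pairings. -/
@[simps]
def AdjointPair.sum (f : AdjointPair β β') :
    AdjointPair (sumPairing ι β) (sumPairing ι β') where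
  fwd := Finsupp.mapRange.linearMap f.fwd
  bwd := Finsupp.mapRange.linearMap f.bwd
  adj := sumPairing_adj_of_single_left fun i x w => by simp [f.adj]

variable (ι) in
/-- A retract stays a retract after taking direct sums of copies. -/
def PairingRetract.sum (f : PairingRetract β β') :
    PairingRetract (sumPairing ι β) (sumPairing ι β') where
  i := f.i.sum ι
  r := f.r.sum ι
  fwd_fwd _ := Finsupp.ext fun _ => f.fwd_fwd _
  bwd_bwd _ := Finsupp.ext fun _ => f.bwd_bwd _

/-- A direct sum of fewer copies of `β` is a retract of a direct sum of more copies: extend by zero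
and restrict along `e`. -/
@[simps]
def PairingRetract.ofEmbedding (β : V →ₗ[k] W →ₗ[k] N) (e : ι ↪ κ) :
    PairingRetract (sumPairing ι β) (sumPairing κ β) where
  i.fwd := Finsupp.lmapDomain V k e
  i.bwd := Finsupp.lcomapDomain e e.injective
  i.adj := sumPairing_adj_of_single_left fun i x w => by
    simp [Finsupp.mapDomain_single, Finsupp.lcomapDomain]
  r.fwd := Finsupp.lcomapDomain e e.injective
  r.bwd := Finsupp.lmapDomain W k e
  r.adj := sumPairing_adj_of_single_right fun i x w => by
    simp [Finsupp.mapDomain_single, Finsupp.lcomapDomain]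
  fwd_fwd := Finsupp.comapDomain_mapDomain _ e.injective
  bwd_bwd := Finsupp.comapDomain_mapDomain _ e.injective

/-- Flattening a direct sum of direct sums along `e : ι × κ ≃ κ`. -/
def AdjointEquiv.absorb (β : V →ₗ[k] W →ₗ[k] N) (e : ι × κ ≃ κ) :
    AdjointEquiv (sumPairing ι (sumPairing κ β)) (sumPairing κ β) where
  fwd := (Finsupp.curryLinearEquiv k).symm.trans (Finsupp.domLCongr e)
  bwd := (Finsupp.domLCongr e.symm).trans (Finsupp.curryLinearEquiv k)
  adj v w := by
    obtain ⟨v, rfl⟩ := (Finsupp.curryLinearEquiv k).surjective v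
    induction v using Finsupp.induction_linear with
    | zero => simp only [map_zero, LinearMap.zero_apply]
    | add v₁ v₂ h₁ h₂ => simp only [map_add, LinearMap.add_apply, h₁, h₂]
    | single p x =>
      have : Finsupp.curryLinearEquiv k (Finsupp.single p x) =
        Finsupp.single p.1 (Finsupp.single p.2 x) := Finsupp.curry_single p x
      rw [LinearEquiv.trans_apply, LinearEquiv.symm_apply_apply, this]
      simp

end Sum

end AdjointPairs

section Resolutions

variable {k V J : Type*} [CommRing k] [AddCommGroup V] [Module k V]

/-- A resolution of a module: orthogonal idempotent endomorphisms whose ranges span the module.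
They add up to the identity, the sum being finite at each element. -/
structure IsResolution (p : J → Module.End k V) : Prop extends OrthogonalIdempotents p where
  iSup_range : ⨆ j, LinearMap.range (p j) = ⊤

namespace IsResolution

variable {p : J → Module.End k V}

theorem apply_apply (hp : IsResolution p) (j : J) (v : V) : p j (p j v) = p j v :=
  LinearMap.congr_fun (hp.idem j) v

theorem apply_apply_of_ne (hp : IsResolution p) {i j : J} (hij : i ≠ j) (v : V) :
    p i (p j v) = 0 :=
  LinearMap.congr_fun (hp.ortho hij) v

theorem eventually_sum_apply_eq (hp : IsResolution p) (v : V) :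
    ∀ᶠ T : Finset J in Filter.atTop, ∑ j ∈ T, p j v = v := by
  have hv : v ∈ ⨆ j, LinearMap.range (p j) := hp.iSup_range ▸ Submodule.mem_top
  induction hv using Submodule.iSup_induction' with
  | mem j x hx =>
    obtain ⟨v, rfl⟩ := hx
    filter_upwards [Filter.eventually_ge_atTop {j}] with T hT
    rw [Finset.sum_eq_single_of_mem j (Finset.singleton_subset_iff.mp hT) fun i _ hij =>
      hp.apply_apply_of_ne hij v, hp.apply_apply]
  | zero => simp
  | add x y _ _ hx hy =>
    filter_upwards [hx, hy] with T hTx hTy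
    simp only [map_add, Finset.sum_add_distrib, hTx, hTy]

theorem exists_finset_sum_apply_eq (hp : IsResolution p) (v : V) :
    ∃ T : Finset J, (∀ j ∉ T, p j v = 0) ∧ ∑ j ∈ T, p j v = v := by
  obtain ⟨T, hT⟩ := Filter.eventually_atTop.mp (hp.eventually_sum_apply_eq v)
  refine ⟨T, fun j hj => ?_, hT T le_rfl⟩
  simpa only [Finset.sum_cons, hT T le_rfl, add_eq_right] using
    hT (T.cons j hj) (Finset.subset_cons hj)

end IsResolution

end Resolutions

section RetractOfFamily

variable {k N V W V' W' U ι J : Type*} [CommRing k] [AddCommGroup N] [Module k N]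
  [AddCommGroup V] [Module k V] [AddCommGroup W] [Module k W]
  [AddCommGroup V'] [Module k V'] [AddCommGroup W'] [Module k W']
  [AddCommGroup U] [Module k U]

/-- A pointwise finite family of linear maps, as a single map into the direct sum. -/
def finsuppOfFinite (f : ι → V →ₗ[k] U) (h : ∀ v, ∃ T : Finset ι, ∀ j ∉ T, f j v = 0) :
    V →ₗ[k] (ι →₀ U) where
  toFun v := Finsupp.ofSupportFinite (fun i => f i v) <| by
    obtain ⟨T, hT⟩ := h v
    exact T.finite_toSet.subset fun j hj => not_imp_comm.mp (hT j) hj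
  map_add' v w := Finsupp.ext fun i => (f i).map_add v w
  map_smul' c v := Finsupp.ext fun i => (f i).map_smul c v

@[simp]
theorem finsuppOfFinite_apply (f : ι → V →ₗ[k] U) (h : ∀ v, ∃ T : Finset ι, ∀ j ∉ T, f j v = 0)
    (v : V) (j : ι) : finsuppOfFinite f h v j = f j v := rfl

theorem lsum_finsuppOfFinite {f : ι → V →ₗ[k] U} (g : ι → U →ₗ[k] V)
    (h : ∀ v, ∃ T : Finset ι, ∀ j ∉ T, f j v = 0) {v : V} {T : Finset ι}
    (hT : ∀ j ∉ T, f j v = 0) :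
    Finsupp.lsum k g (finsuppOfFinite f h v) = ∑ j ∈ T, g j (f j v) := by
  rw [Finsupp.lsum_apply, Finsupp.sum_of_support_subset _ (s := T)]
  · rfl
  · exact fun j hj => not_imp_comm.mp (hT j) (Finsupp.mem_support_iff.mp hj)
  · simp

variable {β : V →ₗ[k] W →ₗ[k] N} {β' : V' →ₗ[k] W' →ₗ[k] N}

/-- Pointwise finite families of adjoint pairs `i j : β → β'` and `r j : β' → β` such that
`∑ j, r j ∘ i j` is the identity make `β` a retract of a direct sum of copies of `β'`. -/
def PairingRetract.ofFamily (i : ι → AdjointPair β β') (r : ι → AdjointPair β' β)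
    (hV : ∀ v, ∃ T : Finset ι, (∀ j ∉ T, (i j).fwd v = 0) ∧
      ∑ j ∈ T, (r j).fwd ((i j).fwd v) = v)
    (hW : ∀ w, ∃ T : Finset ι, (∀ j ∉ T, (r j).bwd w = 0) ∧
      ∑ j ∈ T, (i j).bwd ((r j).bwd w) = w) :
    PairingRetract β (sumPairing ι β') where
  i.fwd := finsuppOfFinite (fun j => (i j).fwd) fun v => (hV v).imp fun _ => And.left
  i.bwd := Finsupp.lsum k fun j => (i j).bwd
  i.adj := sumPairing_adj_of_single_right fun j v y => by simpa using (i j).adj v y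
  r.fwd := Finsupp.lsum k fun j => (r j).fwd
  r.bwd := finsuppOfFinite (fun j => (r j).bwd) fun w => (hW w).imp fun _ => And.left
  r.adj := sumPairing_adj_of_single_left fun j x w => by simpa using (r j).adj x w
  fwd_fwd v := by
    obtain ⟨T, hT, h⟩ := hV v
    exact (lsum_finsuppOfFinite _ (fun v => (hV v).imp fun _ => And.left) hT).trans h
  bwd_bwd w := by
    obtain ⟨T, hT, h⟩ := hW w
    exact (lsum_finsuppOfFinite _ (fun w => (hW w).imp fun _ => And.left) hT).trans h

variable {p : J → AdjointPair β β} {S : J → Type*} [∀ j, Fintype (S j)]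

/-- If the members of a resolution of the pairing `β` are finite sums of adjoint pairs which
factor through `β'`, then `β` is a retract of a direct sum of copies of `β'`. -/
def PairingRetract.ofFactorization (hV : IsResolution fun j => (p j).fwd)
    (hW : IsResolution fun j => (p j).bwd)
    (a : ∀ j, S j → AdjointPair β β') (b : ∀ j, S j → AdjointPair β' β)
    (hfwd : ∀ j v, ∑ s, (b j s).fwd ((a j s).fwd v) = (p j).fwd v)
    (hbwd : ∀ j w, ∑ s, (a j s).bwd ((b j s).bwd w) = (p j).bwd w) :
    PairingRetract β (sumPairing (Σ j, S j) β') :=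
  ofFamily (fun x => (a x.1 x.2).comp (p x.1)) (fun x => (p x.1).comp (b x.1 x.2))
    (fun v => by
      obtain ⟨T, hT, hv⟩ := hV.exists_finset_sum_apply_eq v
      refine ⟨T.sigma fun _ => Finset.univ, fun x hx => ?_, ?_⟩
      · simp [hT x.1 (by simpa using hx)]
      · simp only [Finset.sum_sigma, AdjointPair.comp_fwd, LinearMap.comp_apply, ← map_sum, hfwd,
          hV.apply_apply, hv])
    (fun w => by
      obtain ⟨T, hT, hw⟩ := hW.exists_finset_sum_apply_eq w
      refine ⟨T.sigma fun _ => Finset.univ, fun x hx => ?_, ?_⟩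
      · simp [hT x.1 (by simpa using hx)]
      · simp only [Finset.sum_sigma, AdjointPair.comp_bwd, LinearMap.comp_apply, ← map_sum, hbwd,
          hW.apply_apply, hw])

end RetractOfFamily

section Cardinality

variable {J X : Type*} [Infinite X]

variable (X) in
theorem nonempty_prod_self_equiv : Nonempty (X × X ≃ X) :=
  Cardinal.eq.mp (by simp)

variable (X) in
theorem nonempty_nat_prod_equiv : Nonempty (ℕ × X ≃ X) :=
  Cardinal.eq.mp (by rw [Cardinal.mk_prod]; simp)

theorem nonempty_sigma_embedding (h : Nonempty (J ↪ X)) (S : J → Type*) [∀ j, Countable (S j)] :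
    Nonempty ((Σ j, S j) ↪ X) := by
  obtain ⟨e⟩ := h
  obtain ⟨c⟩ := nonempty_prod_self_equiv X
  have f (j : J) : S j ↪ X := (nonempty_embedding_nat (S j)).some.trans (Infinite.natEmbedding X)
  exact ⟨((Function.Embedding.sigmaMap e f).trans
    (Equiv.sigmaEquivProd X X).toEmbedding).trans c.toEmbedding⟩

end Cardinality

section Swindle

variable {k N V W V' W' V'' W'' X : Type*} [CommRing k] [AddCommGroup N] [Module k N]
  [AddCommGroup V] [Module k V] [AddCommGroup W] [Module k W]
  [AddCommGroup V'] [Module k V'] [AddCommGroup W'] [Module k W']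
  [AddCommGroup V''] [Module k V''] [AddCommGroup W''] [Module k W'']

/-- The orthogonal direct sum of two pairings. -/
def prodPairing (β : V →ₗ[k] W →ₗ[k] N) (β' : V' →ₗ[k] W' →ₗ[k] N) :
    (V × V') →ₗ[k] (W × W') →ₗ[k] N :=
  β.compl₁₂ (LinearMap.fst k V V') (LinearMap.fst k W W') +
    β'.compl₁₂ (LinearMap.snd k V V') (LinearMap.snd k W W')

variable {β : V →ₗ[k] W →ₗ[k] N} {β' : V' →ₗ[k] W' →ₗ[k] N} {β'' : V'' →ₗ[k] W'' →ₗ[k] N}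

variable (β β') in
/-- The direct sum of two pairings is commutative up to isomorphism. -/
def AdjointEquiv.prodComm : AdjointEquiv (prodPairing β β') (prodPairing β' β) where
  fwd := LinearEquiv.prodComm k V V'
  bwd := LinearEquiv.prodComm k W' W
  adj _ _ := add_comm _ _

variable (β) in
/-- Adding the summand `β` on the left to an isomorphism of pairings. -/
def AdjointEquiv.prodLeft (f : AdjointEquiv β' β'') :
    AdjointEquiv (prodPairing β β') (prodPairing β β'') where
  fwd := (LinearEquiv.refl k V).prodCongr f.fwd
  bwd := (LinearEquiv.refl k W).prodCongr f.bwd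
  adj v w := congrArg (β v.1 w.1 + ·) (f.adj v.2 w.2)

/-- The forward map of the Eilenberg swindle:
`(q₀, q₁, …) ↦ (b q₀, (e q₁ + (1 - e) q₀, e q₂ + (1 - e) q₁, …))` with `e = a b`. -/
def swindleFun (a : V →ₗ[k] V') (b : V' →ₗ[k] V) : (ℕ →₀ V') →ₗ[k] V × (ℕ →₀ V') :=
  (b ∘ₗ Finsupp.lapply 0).prod
    (Finsupp.mapRange.linearMap (a ∘ₗ b) ∘ₗ
        Finsupp.lcomapDomain Nat.succ Nat.succ_injective +
      (LinearMap.id - Finsupp.mapRange.linearMap (a ∘ₗ b)))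

/-- The backward map of the Eilenberg swindle:
`(u, (q₀, q₁, …)) ↦ (a u + (1 - e) q₀, e q₀ + (1 - e) q₁, …)` with `e = a b`. -/
def swindleInv (a : V →ₗ[k] V') (b : V' →ₗ[k] V) : V × (ℕ →₀ V') →ₗ[k] (ℕ →₀ V') :=
  (Finsupp.lsingle 0 ∘ₗ a).coprod
    (Finsupp.lmapDomain V' k Nat.succ ∘ₗ Finsupp.mapRange.linearMap (a ∘ₗ b) +
      (LinearMap.id - Finsupp.mapRange.linearMap (a ∘ₗ b)))

section

variable (a : V →ₗ[k] V') (b : V' →ₗ[k] V)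

@[simp]
theorem swindleFun_fst (q : ℕ →₀ V') : (swindleFun a b q).1 = b (q 0) := rfl

@[simp]
theorem swindleFun_snd (q : ℕ →₀ V') (n : ℕ) :
    (swindleFun a b q).2 n = a (b (q (n + 1))) + (q n - a (b (q n))) := rfl

@[simp]
theorem swindleInv_zero (x : V × (ℕ →₀ V')) :
    swindleInv a b x 0 = a x.1 + (x.2 0 - a (b (x.2 0))) := by
  simp [swindleInv, Finsupp.mapDomain_of_notMem_range]

theorem mapDomain_succ_apply_succ (q : ℕ →₀ V) (n : ℕ) :
    Finsupp.mapDomain Nat.succ q (n + 1) = q n :=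
  Finsupp.mapDomain_apply Nat.succ_injective q n

@[simp]
theorem swindleInv_succ (x : V × (ℕ →₀ V')) (n : ℕ) :
    swindleInv a b x (n + 1) = a (b (x.2 n)) + (x.2 (n + 1) - a (b (x.2 (n + 1)))) := by
  simp [swindleInv, mapDomain_succ_apply_succ]

variable {a b} in
/-- The Eilenberg swindle for modules: for a retract `V` of `V'`, a countable direct sum of copies
of `V'` absorbs `V`. -/
def swindleEquiv (h : ∀ u, b (a u) = u) : (ℕ →₀ V') ≃ₗ[k] V × (ℕ →₀ V') where
  __ := swindleFun a b
  invFun := swindleInv a b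
  left_inv q := by
    ext n
    cases n <;> simp [h]
  right_inv x := by
    refine Prod.ext ?_ (Finsupp.ext fun n => ?_)
    · simp [h]
    · cases n <;> simp [h]

end

/-- The Eilenberg swindle: a retract of `β'` is absorbed by countably many copies of `β'`. -/
def PairingRetract.swindle (f : PairingRetract β β') :
    AdjointEquiv (sumPairing ℕ β') (prodPairing β (sumPairing ℕ β')) where
  fwd := swindleEquiv f.fwd_fwd
  bwd := (swindleEquiv f.bwd_bwd).symm
  adj q x := by
    change β (f.r.fwd (q 0)) x.1 + sumPairing ℕ β' (swindleFun f.i.fwd f.r.fwd q).2 x.2 =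
      sumPairing ℕ β' q (swindleInv f.r.bwd f.i.bwd x)
    have adj_shift := (ofEmbedding β' ⟨Nat.succ, Nat.succ_injective⟩).r.adj
    have adj_idem := ((f.i.comp f.r).sum ℕ).adj
    simp only [ofEmbedding_r_fwd, ofEmbedding_r_bwd, Function.Embedding.coeFn_mk,
      AdjointPair.sum_fwd, AdjointPair.sum_bwd, AdjointPair.comp_fwd, AdjointPair.comp_bwd]
      at adj_shift adj_idem
    simp only [swindleFun, swindleInv, LinearMap.prod_apply, Function.prod_apply,
      LinearMap.coprod_apply, LinearMap.add_apply, LinearMap.sub_apply, LinearMap.comp_apply,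
      LinearMap.id_apply, map_add, map_sub, adj_shift, adj_idem, f.r.adj, Finsupp.lsingle_apply,
      sumPairing_single_right]

/-- Pairings which absorb countably many copies of themselves and are retracts of each other are
isomorphic: `β ≅ β' ⊕ β ≅ β ⊕ β' ≅ β'`. -/
def AdjointEquiv.ofRetracts (f : PairingRetract β β') (g : PairingRetract β' β)
    (h : AdjointEquiv (sumPairing ℕ β) β) (h' : AdjointEquiv (sumPairing ℕ β') β') :
    AdjointEquiv β β' :=
  (h.symm.trans (g.swindle.trans (h.prodLeft β'))).trans <|
    (prodComm β' β).trans (h'.symm.trans (f.swindle.trans (h'.prodLeft β))).symm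

theorem nonempty_adjointEquiv_sumPairing [Infinite X] (f : PairingRetract β (sumPairing X β'))
    (g : PairingRetract β' (sumPairing X β)) :
    Nonempty (AdjointEquiv (sumPairing X β) (sumPairing X β')) := by
  obtain ⟨c⟩ := nonempty_prod_self_equiv X
  obtain ⟨d⟩ := nonempty_nat_prod_equiv X
  exact ⟨.ofRetracts ((f.sum X).trans (AdjointEquiv.absorb β' c).toPairingRetract)
    ((g.sum X).trans (AdjointEquiv.absorb β c).toPairingRetract)
    (.absorb β d) (.absorb β' d)⟩

end Swindle

section LocalUnits

variable {k R S M : Type*} [CommRing k] [NonUnitalRing R] [Module k R]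
  [NonUnitalRing S] [Module k S] [AddCommGroup M] [Module k M]

namespace IsOrthogonalLocalUnits

section Left

variable [IsScalarTower k R R] [SMulCommClass k R R] {E : Set R}

theorem isResolution_mulRight (hE : IsOrthogonalLocalUnits k E) :
    IsResolution fun e : E => LinearMap.mulRight k (e : R) where
  idem e := LinearMap.ext fun r => by simp [mul_assoc, hE.idempotent e e.2]
  ortho e f hef := LinearMap.ext fun r => by
    simp [mul_assoc, hE.orthogonal f f.2 e e.2 (Subtype.coe_ne_coe.mpr hef.symm)]
  iSup_range := @DirectSum.IsInternal.submodule_iSup_eq_top _ _ _ (_) _ _ _ _ hE.left_sum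

theorem isResolution_mulLeft (hE : IsOrthogonalLocalUnits k E) :
    IsResolution fun e : E => LinearMap.mulLeft k (e : R) where
  idem e := LinearMap.ext fun r => by simp [← mul_assoc, hE.idempotent e e.2]
  ortho e f hef := LinearMap.ext fun r => by
    simp [← mul_assoc, hE.orthogonal e e.2 f f.2 (Subtype.coe_ne_coe.mpr hef)]
  iSup_range := @DirectSum.IsInternal.submodule_iSup_eq_top _ _ _ (_) _ _ _ _ hE.right_sum

theorem isResolution_left (hE : IsOrthogonalLocalUnits k E) {B : Bimodule k R S M}
    (hB : Submodule.span k {x : M | ∃ (r : R) (m : M), x = B.left r m} = ⊤) :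
    IsResolution fun e : E => B.left e where
  idem e := LinearMap.ext fun m => by simp [← B.mul_left, hE.idempotent e e.2]
  ortho e f hef := LinearMap.ext fun m => by
    simp [← B.mul_left, hE.orthogonal e e.2 f f.2 (Subtype.coe_ne_coe.mpr hef)]
  iSup_range := by
    rw [eq_top_iff, ← hB, Submodule.span_le]
    rintro _ ⟨r, m, rfl⟩
    obtain ⟨T, -, hT⟩ := hE.isResolution_mulLeft.exists_finset_sum_apply_eq r
    rw [← hT, map_sum, LinearMap.sum_apply]
    refine Submodule.sum_mem _ fun e _ => Submodule.mem_iSup_of_mem e ?_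
    exact ⟨B.left r m, (B.mul_left e r m).symm⟩

end Left

theorem isResolution_right [IsScalarTower k S S] [SMulCommClass k S S] {F : Set S}
    (hF : IsOrthogonalLocalUnits k F) {B : Bimodule k R S M}
    (hB : Submodule.span k {x : M | ∃ (m : M) (s : S), x = B.right m s} = ⊤) :
    IsResolution fun f : F => B.right.flip f where
  idem f := LinearMap.ext fun m => by simp [← B.right_mul, hF.idempotent f f.2]
  ortho e f hef := LinearMap.ext fun m => by
    simp [← B.right_mul, hF.orthogonal f f.2 e e.2 (Subtype.coe_ne_coe.mpr hef.symm)]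
  iSup_range := by
    rw [eq_top_iff, ← hB, Submodule.span_le]
    rintro _ ⟨m, s, rfl⟩
    obtain ⟨T, -, hT⟩ := hF.isResolution_mulRight.exists_finset_sum_apply_eq s
    rw [← hT, map_sum]
    refine Submodule.sum_mem _ fun f _ => Submodule.mem_iSup_of_mem f ?_
    exact ⟨B.right m s, (B.right_mul m s f).symm⟩

end IsOrthogonalLocalUnits

namespace Bimodule

theorem IsUnital.left_flip_injective [IsScalarTower k R R] [SMulCommClass k R R]
    {B : Bimodule k R S M} (hB : B.IsUnital) {E : Set R} (hE : IsOrthogonalLocalUnits k E) :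
    Function.Injective B.left.flip := by
  refine (injective_iff_map_eq_zero _).mpr fun m hm => ?_
  obtain ⟨T, -, hT⟩ := (hE.isResolution_left hB.left_unital).exists_finset_sum_apply_eq m
  exact hT ▸ Finset.sum_eq_zero fun e _ => LinearMap.congr_fun hm (e : R)

theorem IsUnital.right_injective [IsScalarTower k S S] [SMulCommClass k S S]
    {B : Bimodule k R S M} (hB : B.IsUnital) {F : Set S} (hF : IsOrthogonalLocalUnits k F) :
    Function.Injective B.right := by
  refine (injective_iff_map_eq_zero _).mpr fun m hm => ?_
  obtain ⟨T, -, hT⟩ := (hF.isResolution_right hB.right_unital).exists_finset_sum_apply_eq m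
  exact hT ▸ Finset.sum_eq_zero fun f _ => LinearMap.congr_fun hm (f : S)

variable (B : Bimodule k R S M)

/-- Multiplication by `r ∈ R` as an endomorphism of the pairing `R × M → M`. -/
def leftMulPair [IsScalarTower k R R] (r : R) : AdjointPair B.left B.left where
  fwd := LinearMap.mulRight k r
  bwd := B.left r
  adj x m := B.mul_left x r m

/-- Multiplication by `s ∈ S` as an endomorphism of the pairing `M × S → M`. -/
def rightMulPair [SMulCommClass k S S] (s : S) : AdjointPair B.right B.right where
  fwd := B.right.flip s
  bwd := LinearMap.mulLeft k s
  adj m x := (B.right_mul m s x).symm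

/-- An element `m` of an `R`-`S`-bimodule `M` as a morphism from the pairing `R × M → M` to the
pairing `M × S → M`. -/
def elemPair (m : M) : AdjointPair B.left B.right where
  fwd := B.left.flip m
  bwd := B.right m
  adj r s := B.left_right r m s

end Bimodule

end LocalUnits

namespace MoritaContext

variable {k R R' M M' X : Type*} [CommRing k]
  [NonUnitalRing R] [Module k R] [NonUnitalRing R'] [Module k R']
  [AddCommGroup M] [Module k M] [AddCommGroup M'] [Module k M']
  (C : MoritaContext k R R' M M')

/-- `τ` as a bilinear map on `M × M'`. -/
def pair : M →ₗ[k] M' →ₗ[k] R :=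
  TensorProduct.curry (C.τ ∘ₗ (balancedRelations C.bimod C.bimod').mkQ)

/-- `τ'` as a bilinear map on `M' × M`. -/
def pair' : M' →ₗ[k] M →ₗ[k] R' :=
  TensorProduct.curry (C.τ' ∘ₗ (balancedRelations C.bimod' C.bimod).mkQ)

theorem pair_left (r : R) (m : M) (m' : M') : C.pair (C.bimod.left r m) m' = r * C.pair m m' :=
  C.τ_left r m m'

theorem pair'_right (m' : M') (m : M) (s : R') :
    C.pair' m' (C.bimod.right m s) = C.pair' m' m * s :=
  C.τ'_right m' m s

theorem left_pair (m₁ : M) (m' : M') (m₂ : M) :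
    C.bimod.left (C.pair m₁ m') m₂ = C.bimod.right m₁ (C.pair' m' m₂) :=
  C.assoc m₁ m' m₂

theorem exists_finset_sum_pair (hτ : Function.Surjective C.τ) (r : R) :
    ∃ S : Finset (M × M'), ∑ p : S, C.pair p.1.1 p.1.2 = r := by
  obtain ⟨t, rfl⟩ := hτ.comp (Submodule.mkQ_surjective _) r
  obtain ⟨S, rfl⟩ := TensorProduct.exists_finset t
  refine ⟨S, (Finset.sum_coe_sort S fun p => C.pair p.1 p.2).trans ?_⟩
  exact (map_sum (C.τ ∘ₗ (balancedRelations C.bimod C.bimod').mkQ) _ S).symm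

theorem exists_finset_sum_pair' (hτ' : Function.Surjective C.τ') (s : R') :
    ∃ S : Finset (M' × M), ∑ p : S, C.pair' p.1.1 p.1.2 = s := by
  obtain ⟨t, rfl⟩ := hτ'.comp (Submodule.mkQ_surjective _) s
  obtain ⟨S, rfl⟩ := TensorProduct.exists_finset t
  refine ⟨S, (Finset.sum_coe_sort S fun p => C.pair' p.1 p.2).trans ?_⟩
  exact (map_sum (C.τ' ∘ₗ (balancedRelations C.bimod' C.bimod).mkQ) _ S).symm

/-- An element `m'` of `M'` as a morphism from the pairing `M × R' → M` to the pairing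
`R × M → M`. -/
def elemPair' (m' : M') : AdjointPair C.bimod.right C.bimod.left where
  fwd := C.pair.flip m'
  bwd := C.pair' m'
  adj m₁ m₂ := C.left_pair m₁ m' m₂

theorem nonempty_retract_left [IsScalarTower k R R] [SMulCommClass k R R] [Infinite X]
    {E : Set R} (hE : IsOrthogonalLocalUnits k E) (hEX : Nonempty (E ↪ X))
    (hM : Submodule.span k {x : M | ∃ (r : R) (m : M), x = C.bimod.left r m} = ⊤)
    (hτ : Function.Surjective C.τ) :
    Nonempty (PairingRetract C.bimod.left (sumPairing X C.bimod.right)) := by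
  choose S hS using fun e : E => C.exists_finset_sum_pair hτ e
  obtain ⟨c⟩ := nonempty_sigma_embedding hEX fun e => S e
  refine ⟨(PairingRetract.ofFactorization (p := fun e : E => C.bimod.leftMulPair e)
    hE.isResolution_mulRight (hE.isResolution_left hM)
    (fun _ s => C.bimod.elemPair s.1.1) (fun _ s => C.elemPair' s.1.2)
    (fun e r => ?_) (fun e m => ?_)).trans (.ofEmbedding _ c)⟩
  · calc ∑ s : S e, C.pair (C.bimod.left r s.1.1) s.1.2
      _ = r * ∑ s : S e, C.pair s.1.1 s.1.2 := by simp only [pair_left, Finset.mul_sum]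
      _ = r * e := by rw [hS]
  · calc ∑ s : S e, C.bimod.right s.1.1 (C.pair' s.1.2 m)
      _ = C.bimod.left (∑ s : S e, C.pair s.1.1 s.1.2) m := by
        simp only [← left_pair, map_sum, LinearMap.sum_apply]
      _ = C.bimod.left e m := by rw [hS]

theorem nonempty_retract_right [IsScalarTower k R' R'] [SMulCommClass k R' R'] [Infinite X]
    {F : Set R'} (hF : IsOrthogonalLocalUnits k F) (hFX : Nonempty (F ↪ X))
    (hM : Submodule.span k {x : M | ∃ (m : M) (s : R'), x = C.bimod.right m s} = ⊤)
    (hτ' : Function.Surjective C.τ') :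
    Nonempty (PairingRetract C.bimod.right (sumPairing X C.bimod.left)) := by
  choose S hS using fun f : F => C.exists_finset_sum_pair' hτ' f
  obtain ⟨c⟩ := nonempty_sigma_embedding hFX fun f => S f
  refine ⟨(PairingRetract.ofFactorization (p := fun f : F => C.bimod.rightMulPair f)
    (hF.isResolution_right hM) hF.isResolution_mulLeft
    (fun _ s => C.elemPair' s.1.1) (fun _ s => C.bimod.elemPair s.1.2)
    (fun f m => ?_) (fun f s => ?_)).trans (.ofEmbedding _ c)⟩
  · calc ∑ s : S f, C.bimod.left (C.pair m s.1.1) s.1.2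
      _ = C.bimod.right m (∑ s : S f, C.pair' s.1.1 s.1.2) := by simp only [left_pair, map_sum]
      _ = C.bimod.right m f := by rw [hS]
  · calc ∑ x : S f, C.pair' x.1.1 (C.bimod.right x.1.2 s)
      _ = (∑ x : S f, C.pair' x.1.1 x.1.2) * s := by simp only [pair'_right, Finset.sum_mul]
      _ = f * s := by rw [hS]

end MoritaContext

namespace FMat

section Mul

variable {k X U V W P Q T : Type*} [CommRing k] [AddCommGroup U] [Module k U]
  [AddCommGroup V] [Module k V] [AddCommGroup W] [Module k W] [AddCommGroup P] [Module k P]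
  [AddCommGroup Q] [Module k Q] [AddCommGroup T] [Module k T]

theorem mul_apply_eq_sum (β : V →ₗ[k] W →ₗ[k] P) (A : FMat X V) (B : FMat X W) {i j : X}
    {S : Finset X} (hS : ∀ l ∉ S, β (A (i, l)) (B (l, j)) = 0) :
    mul β A B (i, j) = ∑ l ∈ S, β (A (i, l)) (B (l, j)) :=
  finsum_eq_sum_of_support_subset _ fun l hl => not_imp_comm.mp (hS l) hl

protected theorem mul_assoc {β₁ : U →ₗ[k] V →ₗ[k] P} {β₂ : P →ₗ[k] W →ₗ[k] Q}
    {β₃ : V →ₗ[k] W →ₗ[k] T} {β₄ : U →ₗ[k] T →ₗ[k] Q}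
    (h : ∀ u v w, β₂ (β₁ u v) w = β₄ u (β₃ v w)) (A : FMat X U) (B : FMat X V) (C : FMat X W) :
    mul β₂ (mul β₁ A B) C = mul β₄ A (mul β₃ B C) := by
  classical
  have hA {i l : X} (hl : l ∉ A.support.image Prod.snd) : A (i, l) = 0 :=
    Finsupp.notMem_support_iff.mp fun hA => hl (Finset.mem_image_of_mem Prod.snd hA)
  have hC {l j : X} (hl : l ∉ C.support.image Prod.fst) : C (l, j) = 0 :=
    Finsupp.notMem_support_iff.mp fun hC => hl (Finset.mem_image_of_mem Prod.fst hC)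
  ext ⟨i, j⟩
  have hAB (l : X) := mul_apply_eq_sum β₁ A B (i := i) (j := l) fun m hm =>
    show β₁ (A (i, m)) (B (m, l)) = 0 by rw [hA hm, map_zero, LinearMap.zero_apply]
  have hBC (m : X) := mul_apply_eq_sum β₃ B C (i := m) (j := j) fun l hl =>
    show β₃ (B (m, l)) (C (l, j)) = 0 by rw [hC hl, map_zero]
  rw [mul_apply_eq_sum β₂ _ _ fun l hl => by rw [hC hl, map_zero],
    mul_apply_eq_sum β₄ _ _ fun m hm => by rw [hA hm, map_zero, LinearMap.zero_apply]]
  simp only [hAB, hBC, map_sum, LinearMap.sum_apply, h]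
  exact Finset.sum_comm

theorem mul_single_right_apply (β : V →ₗ[k] W →ₗ[k] P) (A : FMat X V) (i l j : X) (w : W) :
    mul β A (Finsupp.single (l, j) w) (i, j) = β (A (i, l)) w := by
  rw [mul_apply, finsum_eq_single _ l] <;> simp +contextual [eq_comm]

theorem mul_single_left_apply (β : V →ₗ[k] W →ₗ[k] P) (i l j : X) (v : V) (B : FMat X W) :
    mul β (Finsupp.single (i, l) v) B (i, j) = β v (B (l, j)) := by
  rw [mul_apply, finsum_eq_single _ l] <;> simp +contextual [eq_comm]

theorem eq_of_forall_mul_right_eq {β : V →ₗ[k] W →ₗ[k] P} (hβ : Function.Injective β)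
    {A B : FMat X V} (h : ∀ C, mul β A C = mul β B C) : A = B := by
  ext ⟨i, l⟩
  refine hβ (LinearMap.ext fun w => ?_)
  simpa only [mul_single_right_apply] using DFunLike.congr_fun (h (Finsupp.single (l, l) w)) (i, l)

theorem eq_of_forall_mul_left_eq {β : V →ₗ[k] W →ₗ[k] P} (hβ : Function.Injective β.flip)
    {B C : FMat X W} (h : ∀ A, mul β A B = mul β A C) : B = C := by
  ext ⟨l, j⟩
  refine hβ (LinearMap.ext fun v => ?_)
  simpa only [mul_single_left_apply, LinearMap.flip_apply] using
    DFunLike.congr_fun (h (Finsupp.single (l, l) v)) (l, j)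

end Mul

section RowsAndColumns

variable {k X N V W V' W' : Type*} [CommRing k] [AddCommGroup N] [Module k N]
  [AddCommGroup V] [Module k V] [AddCommGroup W] [Module k W]
  [AddCommGroup V'] [Module k V'] [AddCommGroup W'] [Module k W']

variable (k) in
/-- A matrix as its finitely supported family of rows. -/
def rows : FMat X V ≃ₗ[k] (X →₀ X →₀ V) :=
  Finsupp.curryLinearEquiv k

variable (k) in
/-- A matrix as its finitely supported family of columns. -/
def cols : FMat X V ≃ₗ[k] (X →₀ X →₀ V) :=
  (Finsupp.domLCongr (Equiv.prodComm X X)).trans (Finsupp.curryLinearEquiv k)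

/-- The linear equivalence of matrix modules which applies `φ` to every row. -/
def rowsCongr (φ : (X →₀ V) ≃ₗ[k] (X →₀ W)) : FMat X V ≃ₗ[k] FMat X W :=
  ((rows k).trans (Finsupp.mapRange.linearEquiv φ)).trans (rows k).symm

/-- The linear equivalence of matrix modules which applies `φ` to every column. -/
def colsCongr (φ : (X →₀ V) ≃ₗ[k] (X →₀ W)) : FMat X V ≃ₗ[k] FMat X W :=
  ((cols k).trans (Finsupp.mapRange.linearEquiv φ)).trans (cols k).symm

theorem rows_rowsCongr (φ : (X →₀ V) ≃ₗ[k] (X →₀ W)) (A : FMat X V) (i : X) :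
    rows k (rowsCongr φ A) i = φ (rows k A i) := by
  simp [rowsCongr]

theorem cols_colsCongr (φ : (X →₀ V) ≃ₗ[k] (X →₀ W)) (A : FMat X V) (j : X) :
    cols k (colsCongr φ A) j = φ (cols k A j) := by
  simp [colsCongr]

theorem mul_apply_eq_sumPairing (β : V →ₗ[k] W →ₗ[k] N) (A : FMat X V) (B : FMat X W) (i j : X) :
    mul β A B (i, j) = sumPairing X β (rows k A i) (cols k B j) := by
  rw [sumPairing_apply]
  refine mul_apply_eq_sum β A B fun l hl => ?_
  have hA : A (i, l) = 0 := (Finsupp.notMem_support_iff (f := rows k A i)).mp hl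
  rw [hA, map_zero, LinearMap.zero_apply]

theorem mul_rowsCongr {β : V →ₗ[k] W →ₗ[k] N} {β' : V' →ₗ[k] W' →ₗ[k] N}
    (φ : AdjointEquiv (sumPairing X β) (sumPairing X β')) (A : FMat X V) (B : FMat X W') :
    mul β' (rowsCongr φ.fwd A) B = mul β A (colsCongr φ.bwd B) := by
  ext ⟨i, j⟩
  rw [mul_apply_eq_sumPairing, mul_apply_eq_sumPairing, rows_rowsCongr, cols_colsCongr, φ.adj]

end RowsAndColumns

section Balanced

variable {k R S M X : Type*} [CommRing k] [NonUnitalRing R] [Module k R] [NonUnitalRing S]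
  [Module k S] [AddCommGroup M] [Module k M] {B : Bimodule k R S M}
  {Ψ : FMat X R → FMat X M} {Ψ' : FMat X S → FMat X M}

theorem map_mul_left_of_balanced [IsScalarTower k R R] [SMulCommClass k R R]
    (hB : Function.Injective B.right)
    (h : ∀ A A', mul B.right (Ψ A) A' = mul B.left A (Ψ' A')) (A A₁ : FMat X R) :
    Ψ (mul (LinearMap.mul k R) A A₁) = mul B.left A (Ψ A₁) :=
  eq_of_forall_mul_right_eq hB fun A' => by
    rw [h, FMat.mul_assoc B.mul_left, ← h, FMat.mul_assoc B.left_right]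

theorem map_mul_right_of_balanced [IsScalarTower k S S] [SMulCommClass k S S]
    (hB : Function.Injective B.left.flip)
    (h : ∀ A A', mul B.right (Ψ A) A' = mul B.left A (Ψ' A')) (A' A₁' : FMat X S) :
    Ψ' (mul (LinearMap.mul k S) A' A₁') = mul B.right (Ψ' A') A₁' :=
  eq_of_forall_mul_left_eq hB fun A => by
    rw [← h, ← FMat.mul_assoc fun m s₁ s₂ => (B.right_mul m s₁ s₂).symm, h,
      FMat.mul_assoc B.left_right]

end Balanced

end FMat

end StableMorita

end

theorem theorem7p1_general {k R R' M M' X : Type*} [CommRing k]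
    [NonUnitalRing R] [Module k R] [IsScalarTower k R R] [SMulCommClass k R R]
    [NonUnitalRing R'] [Module k R'] [IsScalarTower k R' R'] [SMulCommClass k R' R']
    [AddCommGroup M] [Module k M] [AddCommGroup M'] [Module k M']
    (E : Set R) (hE : StableMorita.IsOrthogonalLocalUnits k E)
    (F : Set R') (hF : StableMorita.IsOrthogonalLocalUnits k F)
    [Infinite X]
    (hEX : Nonempty (E ↪ X))
    (hFX : Nonempty (F ↪ X))
    (C : StableMorita.MoritaContext k R R' M M')
    (hM : C.bimod.IsUnital)
    (hτ : Function.Surjective C.τ) (hτ' : Function.Surjective C.τ') :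
    ∃ (Ψ : StableMorita.FMat X R ≃ₗ[k] StableMorita.FMat X M)
      (Ψ' : StableMorita.FMat X R' ≃ₗ[k] StableMorita.FMat X M),
      (∀ A B : StableMorita.FMat X R,
        Ψ (StableMorita.FMat.mul (LinearMap.mul k R) A B) =
          StableMorita.FMat.mul C.bimod.left A (Ψ B)) ∧
      (∀ A' B' : StableMorita.FMat X R',
        Ψ' (StableMorita.FMat.mul (LinearMap.mul k R') A' B') =
          StableMorita.FMat.mul C.bimod.right (Ψ' A') B') ∧
      (∀ (A : StableMorita.FMat X R) (A' : StableMorita.FMat X R'),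
        StableMorita.FMat.mul C.bimod.right (Ψ A) A' =
          StableMorita.FMat.mul C.bimod.left A (Ψ' A')) := by
  open StableMorita in
  obtain ⟨f⟩ := C.nonempty_retract_left hE hEX hM.left_unital hτ
  obtain ⟨g⟩ := C.nonempty_retract_right hF hFX hM.right_unital hτ'
  obtain ⟨φ⟩ := nonempty_adjointEquiv_sumPairing f g
  have balanced := FMat.mul_rowsCongr φ
  exact ⟨FMat.rowsCongr φ.fwd, FMat.colsCongr φ.bwd,
    FMat.map_mul_left_of_balanced (hM.right_injective hF) balanced,
    FMat.map_mul_right_of_balanced (hM.left_flip_injective hE) balanced, balanced⟩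

theorem theorem7p1 {k R R' M M' X : Type*} [CommRing k]
    [NonUnitalRing R] [Module k R] [IsScalarTower k R R] [SMulCommClass k R R]
    [NonUnitalRing R'] [Module k R'] [IsScalarTower k R' R'] [SMulCommClass k R' R']
    [AddCommGroup M] [Module k M] [AddCommGroup M'] [Module k M']
    (E : Set R) (hE : StableMorita.IsOrthogonalLocalUnits k E)
    (F : Set R') (hF : StableMorita.IsOrthogonalLocalUnits k F)
    [Infinite X]
    (hEX : Nonempty (E ↪ X))
    (hFX : Nonempty (F ↪ X))
    (C : StableMorita.MoritaContext k R R' M M')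
    (hM : C.bimod.IsUnital) (hM' : C.bimod'.IsUnital)
    (hτ : Function.Surjective C.τ) (hτ' : Function.Surjective C.τ') :
    ∃ (Ψ : StableMorita.FMat X R ≃ₗ[k] StableMorita.FMat X M)
      (Ψ' : StableMorita.FMat X R' ≃ₗ[k] StableMorita.FMat X M),
      (∀ A B : StableMorita.FMat X R,
        Ψ (StableMorita.FMat.mul (LinearMap.mul k R) A B) =
          StableMorita.FMat.mul C.bimod.left A (Ψ B)) ∧
      (∀ A' B' : StableMorita.FMat X R',
        Ψ' (StableMorita.FMat.mul (LinearMap.mul k R') A' B') =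
          StableMorita.FMat.mul C.bimod.right (Ψ' A') B') ∧
      (∀ (A : StableMorita.FMat X R) (A' : StableMorita.FMat X R'),
        StableMorita.FMat.mul C.bimod.right (Ψ A) A' =
          StableMorita.FMat.mul C.bimod.left A (Ψ' A')) :=
  theorem7p1_general E hE F hF hEX hFX C hM hτ hτ'
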